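/- Let $c=2^{\omega}$, let $c^{+}$ be the successor cardinal of $c$, and let $C_\omega c^{+}$ be the set of ordinals $\alpha<c^{+}$ of cofinality at most $\omega$. There exists a family $\{A_y : y\in 3^{\omega}\}$ of mutually disjoint subsets of $C_\omega c^{+}$ each of which is stationary in $c^{+}$ (it meets every closed cofinal subset of $c^+$). Given any such family, put for $x\in 3^{\omega}$ $$B_x=\bigcup\{A_y : y\in 3^{\omega},\ y(n)\neq x(n)\text{ for all } n\in\omega\},$$ and let $$E=\{(x,f)\in 3^{\omega}\times (c^{+})^{\omega} : \sup_n f(n)\in B_x\}$$ carry the topology induced by the product topology, where $3=\{0,1,2\}$ and $c^{+}$ are discrete. Then $E$ is metrizable and $\tau$-Baire, $E\times E$ is a Baire space, $E\times E\times E$ is not a Baire space, and $E\times E$ is not $\tau$-Baire. Here a topological space $X$ is called $\tau$-Baire if in the following game on $X$ for every strategy of player $\beta'$ there exists a strategy of player $\alpha'$ which wins against it. The players choose non-empty open subsets of $X$ in the order $$V_1,\ V_1',\ W_1,\ W_1',\ V_2,\ V_2',\ W_2,\ W_2',\ \dots,$$ where $\beta'$ chooses the sets $V_k$ and $W_k$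 and $\alpha'$ chooses the sets $V_k'$ and $W_k'$, subject to $V_k\supset V_k'\supset V_{k+1}$ and $W_k\supset W_k'\supset W_{k+1}$ for all $k\geq 1$. A strategy may use all previous moves of both players on both boards. Player $\alpha'$ wins if both $\bigcap_{k} V_k\neq\emptyset$ and $\bigcap_{k} W_k\neq\emptyset$; otherwise $\beta'$ wins. -/

import Mathlib

/-! ## The tandem Banach-Mazur game -/

namespace TandemGame

/-- A move in a Banach-Mazur type game on `X`: a non-empty open subset of `X`. -/
abbrev Move (X : Type*) [TopologicalSpace X] : Type _ :=
  {U : TopologicalSpace.Opens X // (U : Set X).Nonempty}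

/- The moves of a play are numbered in chronological order `0, 1, 2, …`: for every `k`,
move `4k` is `V_{k+1}` (player `β'`), move `4k+1` is `V'_{k+1}` (player `α'`),
move `4k+2` is `W_{k+1}` (player `β'`), move `4k+3` is `W'_{k+1}` (player `α'`).
A history of length `n` is a sequence `Fin n → Move X` of the moves `0, …, n-1`.
So `β'` moves after histories of even length and `α'` after histories of odd length. -/

/-- A strategy of player `β'`, with full information on the past of both boards. The opening
moves `V_1` and `W_1` (after histories of length `0` and `2`) are unrestricted; every later move,
after a history of length `2 * k + 4`, has to be contained in the last move of `α'` on the same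
board, that is in move number `2 * k + 1`. The values on histories of odd length are irrelevant. -/
structure BetaStrategy (X : Type*) [TopologicalSpace X] where
  move : (n : ℕ) → (Fin n → Move X) → Move X
  legal : ∀ (k : ℕ) (h : Fin (2 * k + 4) → Move X), move (2 * k + 4) h ≤ h ⟨2 * k + 1, by omega⟩

/-- A strategy of player `α'`, with full information on the past of both boards: the answer has
to be contained in the move that `β'` has just made. The values on histories of even length are
irrelevant. -/
structure AlphaStrategy (X : Type*) [TopologicalSpace X] where
  move : (n : ℕ) → (Fin n → Move X) → Move X
  legal : ∀ (k : ℕ) (h : Fin (2 * k + 1) → Move X), move (2 * k + 1) h ≤ h (Fin.last (2 * k))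

variable {X : Type*} [TopologicalSpace X]

/-- The play of the strategy `a` of player `α'` against the strategy `b` of player `β'`. -/
def play (a : AlphaStrategy X) (b : BetaStrategy X) (n : ℕ) : Move X :=
  if n % 2 = 0 then b.move n (fun i : Fin n => play a b i)
  else a.move n (fun i : Fin n => play a b i)
termination_by n
decreasing_by all_goals exact i.2

/-- The strategy `a` of player `α'` wins against the strategy `b` of player `β'`: on both boards
the sets chosen in the play of `a` against `b` have a common point. -/
def Beats (a : AlphaStrategy X) (b : BetaStrategy X) : Prop :=
  (⋂ k : ℕ, ((play a b (4 * k)).1 : Set X)).Nonempty ∧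
    (⋂ k : ℕ, ((play a b (4 * k + 2)).1 : Set X)).Nonempty

end TandemGame

/-- `X` is a `τ`-Baire space: every strategy of player `β'` in the tandem Banach-Mazur game on `X`
is beaten by some strategy of player `α'`. -/
def IsTauBaire (X : Type*) [TopologicalSpace X] : Prop :=
  ∀ b : TandemGame.BetaStrategy X, ∃ a : TandemGame.AlphaStrategy X, TandemGame.Beats a b

/-! ## The space `E` -/

/-- The cardinal `c⁺`, the successor of the cardinality `c` of the continuum, as the well-ordered
set of all ordinals below it. -/
abbrev CPlus : Type := (Order.succ Cardinal.continuum.{0}).ord.ToType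

/-- The set `c⁺` carries the discrete topology. -/
instance CPlus.instTopologicalSpace : TopologicalSpace CPlus := ⊥

instance CPlus.instDiscreteTopology : DiscreteTopology CPlus := ⟨rfl⟩

/-- `C_ω c⁺`, the set of all ordinals `α < c⁺` of cofinality at most `ω`. -/
def COmega : Set CPlus := {α | Order.cof (Set.Iio α) ≤ Cardinal.aleph0}

/-- `{A_y : y ∈ 3^ω}` is a family of mutually disjoint stationary subsets of `C_ω c⁺`. -/
structure IsDisjointStationaryFamily (A : (ℕ → Fin 3) → Set CPlus) : Prop where
  subset : ∀ y, A y ⊆ COmega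
  stationary : ∀ y, IsStationary (A y)
  disjoint : ∀ y z, y ≠ z → Disjoint (A y) (A z)

/-- `B_x` is the union of all `A_y` such that `y(n) ≠ x(n)` for all `n`. -/
def unionAvoiding (A : (ℕ → Fin 3) → Set CPlus) (x : ℕ → Fin 3) : Set CPlus :=
  {γ | ∃ y : ℕ → Fin 3, (∀ n, y n ≠ x n) ∧ γ ∈ A y}

/-- The space `E` of all `(x, f) ∈ 3^ω × (c⁺)^ω` with `sup f ∈ B_x`, with the topology induced by
the product topology, `3` and `c⁺` being discrete. -/
abbrev SpaceE (A : (ℕ → Fin 3) → Set CPlus) : Type :=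
  {p : (ℕ → Fin 3) × (ℕ → CPlus) // ∃ γ ∈ unionAvoiding A p.1, IsLUB (Set.range p.2) γ}

/-!
Player `α'` answers every move by a cylinder of `E` that decides many coordinates and an ordinal
above a threshold. Once the strategy of `β'` is fixed, the thresholds `d : ℕ → c⁺` determine the
play, and the two limit branches depend continuously on `d`. Let two players build `d`, one naming
lower bounds for the next term and the other choosing that term. Some pair of branches
`r = (x, x')` cannot be avoided by the first player: there are only `c` pairs, so strategies
avoiding each of them would have a common upper bound, which would avoid all pairs at once. If the
second player keeps `r` unavoidable, then for club many `γ` the play can be kept below `γ`, and for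
`γ` of countable cofinality it can moreover be made to have branches `r` and supremum `γ` on both
boards. As `3` has three elements, some `y` differs from `x` and from `x'` everywhere, and such a
`γ` in `A_y` makes `α'` win.

For a generic pair of points of `E` the two suprema coincide. So a generic triple with branches
starting with `0`, `1`, `2` would have a common supremum in a single `A_y`, leaving no value for
`y(0)`. Hence `E × E × E` is not Baire. The square of a `τ`-Baire space is Baire, as `β'` can steer
both boards through a given sequence of dense open sets; so `E × E` is Baire, and it is not
`τ`-Baire because its square maps openly onto `E × E × E`.
-/

open Cardinal Order Set Topology Filter TandemGame
open scoped Function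

universe u

section WellOrder

variable {α : Type u} [LinearOrder α]

theorem exists_forall_mem_lt {s : Set α} (hs : #s < cof α) : ∃ b, ∀ a ∈ s, a < b :=
  not_isCofinal_iff.1 fun h ↦ (cof_le h).not_gt hs

theorem exists_forall_apply_lt {ι : Type u} (hι : #ι < cof α) (f : ι → α) : ∃ b, ∀ i, f i < b := by
  simpa using exists_forall_mem_lt (mk_range_le.trans_lt hι : #(range f) < cof α)

theorem noMaxOrder_of_aleph0_lt_cof (hα : ℵ₀ < cof α) : NoMaxOrder α :=
  ⟨fun a ↦ by simpa using exists_forall_mem_lt ((countable_singleton a).le_aleph0.trans_lt hα)⟩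

theorem exists_isLUB_of_bddAbove [WellFoundedLT α] {s : Set α} (hs : BddAbove s) :
    ∃ a, IsLUB s a :=
  ⟨wellFounded_lt.min _ hs, wellFounded_lt.min_mem _ hs, fun _ hb ↦
    not_lt.1 (wellFounded_lt.not_lt_min _ hb)⟩

theorem exists_isLUB_range [WellFoundedLT α] {ι : Type*} [Countable ι] (hα : ℵ₀ < cof α)
    (f : ι → α) : ∃ a, IsLUB (range f) a := by
  obtain ⟨b, hb⟩ := exists_forall_mem_lt ((countable_range f).le_aleph0.trans_lt hα)
  exact exists_isLUB_of_bddAbove ⟨b, fun a ha ↦ (hb a ha).le⟩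

theorem cof_Iio_le_aleph0 {u : ℕ → α} {γ : α} (hu : ∀ n, u n < γ) (hγ : IsLUB (range u) γ) :
    cof (Iio γ) ≤ ℵ₀ := by
  have hcofinal : IsCofinal (range fun n ↦ (⟨u n, hu n⟩ : Iio γ)) := fun b ↦ by
    obtain ⟨_, ⟨n, rfl⟩, hn⟩ := (lt_isLUB_iff hγ).1 b.2
    exact ⟨_, mem_range_self n, hn.le⟩
  exact (cof_le hcofinal).trans (countable_range _).le_aleph0

theorem exists_monotone_cofinal_of_cof_Iio_le {γ a : α} (hγ : cof (Iio γ) ≤ ℵ₀) (ha : a < γ) :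
    ∃ e : ℕ → α, Monotone e ∧ (∀ n, e n < γ) ∧ ∀ ε < γ, ∃ n, ε ≤ e n := by
  obtain ⟨s, hs, hcard⟩ := exists_cof_eq (Iio γ)
  have hne : s.Nonempty := (hs ⟨a, ha⟩).imp fun _ h ↦ h.1
  obtain ⟨e, rfl⟩ := (le_aleph0_iff_set_countable.1 (hcard.trans_le hγ)).exists_eq_range hne
  refine ⟨fun n ↦ partialSups e n, fun m n h ↦ (partialSups e).monotone h,
    fun n ↦ (partialSups e n).2, fun ε hε ↦ ?_⟩
  obtain ⟨_, ⟨n, rfl⟩, hn⟩ := hs ⟨ε, hε⟩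
  exact ⟨n, hn.trans (le_partialSups e n)⟩

theorem isClub_Ioi [NoMaxOrder α] (a : α) : IsClub (Ioi a) where
  dirSupClosed := fun d hd ⟨t, ht⟩ _ γ hγ ↦ (hd ht).trans_le (hγ.1 ht)
  isCofinal := fun b ↦ by
    obtain ⟨c, hc⟩ := exists_gt (max a b)
    exact ⟨c, (le_max_left a b).trans_lt hc, ((le_max_right a b).trans_lt hc).le⟩

theorem isStationary_setOf_cof_Iio_le_aleph0 [WellFoundedLT α] (hα : ℵ₀ < cof α) :
    IsStationary {a : α | cof (Iio a) ≤ ℵ₀} := by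
  intro t ht
  have := noMaxOrder_of_aleph0_lt_cof hα
  have hstep : ∀ a : α, ∃ b ∈ t, a < b := fun a ↦ by
    obtain ⟨c, hac⟩ := exists_gt a
    exact (ht.isCofinal c).imp fun b hb ↦ ⟨hb.1, hac.trans_le hb.2⟩
  choose g hgt hg using hstep
  obtain ⟨a⟩ : Nonempty α := cof_ne_zero_iff.1 (aleph0_pos.trans hα).ne'
  let u (n : ℕ) : α := g^[n + 1] a
  have hu (n : ℕ) : u (n + 1) = g (u n) := Function.iterate_succ_apply' g (n + 1) a
  obtain ⟨γ, hγ⟩ := exists_isLUB_range hα u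
  have hlt (n : ℕ) : u n < γ := ((hg _).trans_eq (hu n).symm).trans_le (hγ.1 ⟨n + 1, rfl⟩)
  have hut : range u ⊆ t := range_subset_iff.2 fun n ↦ by
    rw [show u n = g (g^[n] a) from Function.iterate_succ_apply' g n a]
    exact hgt _
  exact ⟨γ, cof_Iio_le_aleph0 hlt hγ, ht.isLUB_mem hut (range_nonempty u) hγ⟩

theorem exists_mem_forall_mem_list_lt {t : Set α} (ht : t.Nonempty) {s : List α}
    (hs : ∀ a ∈ s, ∃ b ∈ t, a < b) : ∃ b ∈ t, ∀ a ∈ s, a < b := by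
  have := ht.to_subtype
  have hev : ∀ᶠ b : t in atTop, ∀ a ∈ {a | a ∈ s}, a < b :=
    (eventually_all_finite s.finite_toSet).2 fun a ha ↦ by
      obtain ⟨b, hb, hab⟩ := hs a ha
      exact (eventually_ge_atTop ⟨b, hb⟩).mono fun c hc ↦ hab.trans_le hc
  obtain ⟨b, hb⟩ := hev.exists
  exact ⟨b, b.2, hb⟩

theorem exists_forall_list_lt (hα : ℵ₀ < cof α) {β : α} (hβ : #(Iio β) < cof α)
    (H : List α → α) : ∃ b, ∀ s : List α, (∀ a ∈ s, a < β) → H s < b := by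
  have hcard : #(List (Iio β)) < cof α := (mk_list_le_max _).trans_lt (max_lt hα hβ)
  obtain ⟨b, hb⟩ := exists_forall_apply_lt hcard fun s ↦ H (s.map Subtype.val)
  refine ⟨b, fun s hs ↦ ?_⟩
  lift s to List (Iio β) using hs
  exact hb s

theorem isClub_setOf_forall_list_lt [WellFoundedLT α] (hα : ℵ₀ < cof α)
    (hIio : ∀ a : α, #(Iio a) < cof α) (H : List α → α) :
    IsClub {γ | ∀ s : List α, (∀ a ∈ s, a < γ) → H s < γ} := by
  constructor
  · intro d hd hne _ γ hγ s hs
    obtain ⟨t, ht, hst⟩ := exists_mem_forall_mem_list_lt hne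
      fun a ha ↦ (lt_isLUB_iff hγ).1 (hs a ha)
    exact (hd ht s hst).trans_le (hγ.1 ht)
  · intro a
    choose g hg using fun b ↦ exists_forall_list_lt hα (hIio b) H
    obtain ⟨γ, hγ⟩ := exists_isLUB_range hα fun n ↦ g^[n] a
    refine ⟨γ, fun s hs ↦ ?_, hγ.1 ⟨0, rfl⟩⟩
    obtain ⟨_, ⟨n, rfl⟩, hn⟩ := exists_mem_forall_mem_list_lt (range_nonempty _)
      fun a ha ↦ (lt_isLUB_iff hγ).1 (hs a ha)
    exact (hg _ s hn).trans_le (hγ.1 ⟨n + 1, Function.iterate_succ_apply' g n a⟩)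

-- Ulam's matrix: injections `g a : Iio a ↪ ι` label the pairs `b < a`. Each row `b` has a label
-- `ξ b` occurring stationarily often, and the rows sharing one label are pairwise disjoint.
theorem exists_pairwise_disjoint_isStationary_subset [WellFoundedLT α] {ι : Type u} [Infinite ι]
    (hι : #ι < cof α) (hIio : ∀ a : α, #(Iio a) ≤ #ι) {S : Set α} (hS : IsStationary S) :
    ∃ A : ι → Set α, (∀ i, A i ⊆ S) ∧ (∀ i, IsStationary (A i)) ∧ Pairwise (Disjoint on A) := by
  have hα : ℵ₀ < cof α := (aleph0_le_mk ι).trans_lt hι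
  have := noMaxOrder_of_aleph0_lt_cof hα
  have g (a : α) : Iio a ↪ ι := ((Cardinal.le_def _ _).1 (hIio a)).some
  let T (b : α) (i : ι) : Set α := {a ∈ S | ∃ h : b < a, g a ⟨b, h⟩ = i}
  have hT (b : α) : ∃ i, IsStationary (T b i) := by
    refine (isStationary_iUnion_iff hα.ne' (by simpa using hι)).1 fun t ht ↦ ?_
    obtain ⟨a, haS, hat, hba⟩ := hS (ht.inter hα.ne' (isClub_Ioi b))
    exact ⟨a, mem_iUnion.2 ⟨_, haS, hba, rfl⟩, hat⟩
  choose ξ hξ using hT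
  obtain ⟨i, hi⟩ := infinite_pigeonhole_card_lt ξ (hι.trans_le (cof_le_cardinalMk α))
    ((aleph0_le_mk ι).trans (hι.trans_le (cof_le_cardinalMk α)).le)
  obtain ⟨e⟩ := (Cardinal.le_def _ _).1 hi.le
  refine ⟨fun j ↦ T (e j) i, fun j a ha ↦ ha.1, fun j ↦ ?_, fun j k hjk ↦ ?_⟩
  · have hstationary := hξ (e j)
    rwa [show ξ (e j) = i from (e j).2] at hstationary
  · refine Set.disjoint_left.2 fun a ⟨_, _, hj⟩ ⟨_, _, hk⟩ ↦ hjk (e.injective (Subtype.ext ?_))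
    exact Subtype.mk.inj ((g a).injective (hj.trans hk.symm))

end WellOrder

section ThresholdGame

open PiNat

theorem forall_mem_res {α : Type*} {p : α → Prop} {d : ℕ → α} {n : ℕ} :
    (∀ a ∈ res d n, p a) ↔ ∀ m < n, p (d m) := by
  induction n with
  | zero => simp
  | succ n ih => rw [res_succ, List.forall_mem_cons, ih, Nat.forall_lt_succ_right, and_comm]

theorem exists_forall_apply_eq_res {α : Type*} (g : List α → α) :
    ∃ d : ℕ → α, ∀ n, d n = g (res d n) := by
  let l : ℕ → List α := fun n ↦ Nat.rec [] (fun _ s ↦ g s :: s) n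
  have hl (n : ℕ) : res (fun n ↦ g (l n)) n = l n := by
    induction n with
    | zero => rfl
    | succ n ih => rw [res_succ, ih]
  exact ⟨fun n ↦ g (l n), fun n ↦ by rw [hl]⟩

theorem exists_res_length_eq {α : Type*} [Nonempty α] (s : List α) :
    ∃ d : ℕ → α, res d s.length = s := by
  induction s with
  | nil => exact ⟨fun _ ↦ Classical.arbitrary α, rfl⟩
  | cons a s ih =>
    obtain ⟨d, hd⟩ := ih
    have hagree : res (Function.update d s.length a) s.length = res d s.length :=
      res_eq_res.2 fun m hm ↦ Function.update_of_ne hm.ne _ _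
    exact ⟨Function.update d s.length a, by
      rw [List.length_cons, res_succ, Function.update_self, hagree, hd]⟩

theorem hasBasis_nhds_cylinder {E : ℕ → Type*} [∀ n, TopologicalSpace (E n)]
    [∀ n, DiscreteTopology (E n)] (x : ∀ n, E n) :
    (𝓝 x).HasBasis (fun _ ↦ True) (PiNat.cylinder x) := by
  refine ⟨fun U ↦ ⟨fun hU ↦ ?_, fun ⟨n, _, hn⟩ ↦
    mem_of_superset ((isOpen_cylinder E x n).mem_nhds (self_mem_cylinder x n)) hn⟩⟩
  obtain ⟨_, ⟨y, n, rfl⟩, hx, hU⟩ := (isTopologicalBasis_cylinders E).mem_nhds_iff.1 hU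
  exact ⟨n, trivial, mem_cylinder_iff_eq.1 hx ▸ hU⟩

theorem continuous_of_dependsOn_Iio {α β : Type*} [TopologicalSpace α] [DiscreteTopology α]
    [TopologicalSpace β] {f : (ℕ → α) → β} {n : ℕ} (hf : DependsOn f (Iio n)) : Continuous f := by
  refine continuous_iff_continuousAt.2 fun x ↦ continuousAt_const.congr (f := fun _ ↦ f x) ?_
  filter_upwards [(hasBasis_nhds_cylinder x).mem_of_mem (i := n) trivial] with y hy
  exact hf fun i hi ↦ (hy i hi).symm

variable {α : Type u} [LinearOrder α] {R : Type u} {Φ : (ℕ → α) → R} {r : R} {s : List α}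

/-- Two players determine a sequence `d`: the first names a lower bound for the next term, the
second chooses that term. `CanAvoid Φ r s` says that from the position `s` the first player has a
strategy that prevents `Φ d = r`. As in `PiNat.res`, positions list the latest term first. -/
def CanAvoid (Φ : (ℕ → α) → R) (r : R) (s : List α) : Prop :=
  ∃ σ : List α → α, ∀ d : ℕ → α, res d s.length = s →
    (∀ n, s.length ≤ n → σ (res d n) ≤ d n) → Φ d ≠ r

theorem exists_not_canAvoid_nil (hR : #R < cof α) (Φ : (ℕ → α) → R) :
    ∃ r, ¬ CanAvoid Φ r [] := by
  by_contra! h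
  choose σ hσ using h
  choose τ hτ using fun s ↦ exists_forall_apply_lt hR fun r ↦ σ r s
  obtain ⟨d, hd⟩ := exists_forall_apply_eq_res τ
  exact hσ (Φ d) d rfl (fun n _ ↦ (hd n).symm ▸ (hτ _ _).le) rfl

theorem exists_not_canAvoid_cons (h : ¬ CanAvoid Φ r s) (ε : α) :
    ∃ a, ε ≤ a ∧ ¬ CanAvoid Φ r (a :: s) := by
  contrapose! h
  have : Nonempty α := ⟨ε⟩
  choose! σ hσ using h
  have hbound (t : List α) : ∃ b, ε ≤ b ∧ ∀ a ∈ t, σ a t ≤ b := by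
    obtain ⟨b, hb⟩ := ((t.finite_toSet.image fun a ↦ σ a t).insert ε).bddAbove
    exact ⟨b, hb (mem_insert _ _), fun a ha ↦ hb (mem_insert_of_mem _ (mem_image_of_mem _ ha))⟩
  choose τ hετ hστ using hbound
  refine ⟨τ, fun d hd hτd ↦ hσ (d s.length) ((hετ _).trans (hτd _ le_rfl)) d ?_ fun n hn ↦ ?_⟩
  · rw [List.length_cons, res_succ, hd]
  · exact (hστ _ _ (forall_mem_res.1 (fun _ h ↦ h) _ hn)).trans (hτd n (Nat.le_of_succ_le hn))

theorem exists_eq_of_not_canAvoid [Nonempty α] (h : ¬ CanAvoid Φ r s) :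
    ∃ d, res d s.length = s ∧ Φ d = r := by
  by_contra! h'
  exact h ⟨fun _ ↦ Classical.arbitrary α, fun d hd _ ↦ h' d hd⟩

theorem exists_isClub_forall_exists_seq [WellFoundedLT α] (hα : ℵ₀ < cof α)
    (hIio : ∀ a : α, #(Iio a) < cof α) {f : List α → α → α} (hf : ∀ s ε, ε ≤ f s ε) :
    ∃ C, IsClub C ∧ ∀ γ ∈ C, cof (Iio γ) ≤ ℵ₀ → ∃ d : ℕ → α,
      (∀ n, d n < γ) ∧ (∀ ε < γ, ∀ᶠ n in atTop, ε ≤ d n) ∧ ∀ n, ∃ ε, d n = f (res d n) ε := by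
  obtain ⟨a⟩ : Nonempty α := cof_ne_zero_iff.1 (aleph0_pos.trans hα).ne'
  let H : List α → α
    | [] => a
    | ε :: s => f s ε
  refine ⟨_, isClub_setOf_forall_list_lt hα hIio H, fun γ hC hγ ↦ ?_⟩
  obtain ⟨e, he_mono, heγ, he⟩ := exists_monotone_cofinal_of_cof_Iio_le hγ (hC [] (by simp))
  obtain ⟨d, hd⟩ := exists_forall_apply_eq_res fun s ↦ f s (e s.length)
  simp only [res_length] at hd
  refine ⟨d, fun n ↦ ?_, fun ε hε ↦ ?_, fun n ↦ ⟨_, hd n⟩⟩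
  · induction n using Nat.strong_induction_on with
    | _ n ih =>
      rw [hd n]
      exact hC (e n :: res d n) (List.forall_mem_cons.2 ⟨heγ n, forall_mem_res.2 ih⟩)
  · obtain ⟨m, hm⟩ := he ε hε
    filter_upwards [eventually_ge_atTop m] with n hn
    rw [hd n]
    exact (hm.trans (he_mono hn)).trans (hf _ _)

variable [TopologicalSpace α] [DiscreteTopology α]

theorem exists_isClub_forall_apply_lt [WellFoundedLT α] {ι : Type*} [Countable ι] (hα : ℵ₀ < cof α)
    (hIio : ∀ a : α, #(Iio a) < cof α) {F : ι → (ℕ → α) → α} (hF : ∀ j, Continuous (F j)) :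
    ∃ C, IsClub C ∧ ∀ γ ∈ C, ∀ d : ℕ → α, (∀ n, d n < γ) → ∀ j, F j d < γ := by
  have : Nonempty α := cof_ne_zero_iff.1 (aleph0_pos.trans hα).ne'
  choose ext hext using exists_res_length_eq (α := α)
  choose bound hbound using fun s ↦
    exists_forall_mem_lt ((countable_range fun j ↦ F j (ext s)).le_aleph0.trans_lt hα)
  refine ⟨_, isClub_setOf_forall_list_lt hα hIio bound, fun γ hγ d hd j ↦ ?_⟩
  obtain ⟨n, -, hn⟩ := (hasBasis_nhds_cylinder d).mem_iff.1
    ((isOpen_discrete {F j d}).preimage (hF j) |>.mem_nhds rfl)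
  have hext_mem : ext (res d n) ∈ cylinder d n := by
    rw [cylinder_eq_res]
    simpa using hext (res d n)
  rw [← mem_singleton_iff.1 (hn hext_mem)]
  exact (hbound _ _ (mem_range_self j)).trans (hγ _ (forall_mem_res.2 fun m _ ↦ hd m))

theorem exists_isClub_exists_apply_eq [WellFoundedLT α] [TopologicalSpace R] [T1Space R]
    (hα : ℵ₀ < cof α) (hIio : ∀ a : α, #(Iio a) < cof α) (hR : #R < cof α) (hΦ : Continuous Φ) :
    ∃ r, ∃ C, IsClub C ∧ ∀ γ ∈ C, cof (Iio γ) ≤ ℵ₀ → ∃ d,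
      (∀ n, d n < γ) ∧ (∀ ε < γ, ∀ᶠ n in atTop, ε ≤ d n) ∧ Φ d = r := by
  have : Nonempty α := cof_ne_zero_iff.1 (aleph0_pos.trans hα).ne'
  obtain ⟨r, hr⟩ := exists_not_canAvoid_nil hR Φ
  have hstep (s : List α) (ε : α) :
      ∃ a, ε ≤ a ∧ (¬ CanAvoid Φ r s → ¬ CanAvoid Φ r (a :: s)) := by
    by_cases h : CanAvoid Φ r s
    · exact ⟨ε, le_rfl, fun h' ↦ absurd h h'⟩
    · exact (exists_not_canAvoid_cons h ε).imp fun a ha ↦ ⟨ha.1, fun _ ↦ ha.2⟩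
  choose pick hle hkeep using hstep
  obtain ⟨C, hC, hCd⟩ := exists_isClub_forall_exists_seq hα hIio hle
  refine ⟨r, C, hC, fun γ hγC hγ ↦ ?_⟩
  obtain ⟨d, hdγ, hd, hdpick⟩ := hCd γ hγC hγ
  have hnot (n : ℕ) : ¬ CanAvoid Φ r (res d n) := by
    induction n with
    | zero => exact hr
    | succ n ih =>
      obtain ⟨ε, hε⟩ := hdpick n
      rw [res_succ, hε]
      exact hkeep _ _ ih
  refine ⟨d, hdγ, hd, ?_⟩
  have hclosed : IsClosed (Φ ⁻¹' {r}) := isClosed_singleton.preimage hΦ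
  refine hclosed.closure_subset <|
    (mem_closure_iff_nhds_basis (hasBasis_nhds_cylinder d)).2 fun n _ ↦ ?_
  obtain ⟨d', hd', h⟩ := exists_eq_of_not_canAvoid (hnot n)
  exact ⟨d', h, by rw [cylinder_eq_res]; simpa using hd'⟩

end ThresholdGame

namespace TandemGame

variable {X : Type*} [TopologicalSpace X]

theorem play_of_even (a : AlphaStrategy X) (b : BetaStrategy X) {n : ℕ} (hn : Even n) :
    play a b n = b.move n fun i : Fin n ↦ play a b i := by
  rw [play, if_pos (Nat.even_iff.1 hn)]

theorem play_of_odd (a : AlphaStrategy X) (b : BetaStrategy X) {n : ℕ} (hn : Odd n) :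
    play a b n = a.move n fun i : Fin n ↦ play a b i := by
  rw [play, if_neg (Nat.odd_iff.1 hn ▸ one_ne_zero)]

theorem play_two_mul_add_one_le (a : AlphaStrategy X) (b : BetaStrategy X) (k : ℕ) :
    play a b (2 * k + 1) ≤ play a b (2 * k) := by
  rw [play_of_odd a b (odd_two_mul_add_one k)]
  exact a.legal k _

theorem play_two_mul_add_four_le (a : AlphaStrategy X) (b : BetaStrategy X) (k : ℕ) :
    play a b (2 * k + 4) ≤ play a b (2 * k + 1) := by
  rw [play_of_even a b (by grind)]
  exact b.legal k _

namespace BetaStrategy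

/-- The strategy of player `β'` which opens with the pair `U` on the two boards and, from the pair
of answers of `α'` in a round, determines both of its moves in the next round by means of `B`. -/
def ofRounds (U : Move X × Move X) (B : ℕ → Move X × Move X → Move X × Move X)
    (hB : ∀ k S, B k S ≤ S) : BetaStrategy X where
  move
    | 0, _ | 1, _ => U.1
    | 2, _ | 3, _ => U.2
    | n + 4, s =>
      let S := B (n / 4) (s ⟨4 * (n / 4) + 1, by lia⟩, s ⟨4 * (n / 4) + 3, by lia⟩)
      if n % 4 < 2 then S.1 else S.2
  legal k s := by
    dsimp only
    split_ifs with hk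
    · convert (hB _ _).1 using 3
      lia
    · convert (hB _ _).2 using 3
      lia

variable {U : Move X × Move X} {B : ℕ → Move X × Move X → Move X × Move X}
  {hB : ∀ k S, B k S ≤ S}

theorem play_ofRounds_opening (a : AlphaStrategy X) :
    (play a (ofRounds U B hB) 0, play a (ofRounds U B hB) 2) = U := by
  rw [play_of_even _ _ Even.zero, play_of_even _ _ even_two]
  rfl

theorem play_ofRounds_add_four (a : AlphaStrategy X) {n : ℕ} (hn : Even n) :
    play a (ofRounds U B hB) (n + 4) =
      let S := B (n / 4) (play a (ofRounds U B hB) (4 * (n / 4) + 1),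
        play a (ofRounds U B hB) (4 * (n / 4) + 3))
      if n % 4 < 2 then S.1 else S.2 := by
  rw [play_of_even _ _ (hn.add (by decide))]
  rfl

theorem play_ofRounds_succ (a : AlphaStrategy X) (k : ℕ) :
    (play a (ofRounds U B hB) (4 * (k + 1)), play a (ofRounds U B hB) (4 * (k + 1) + 2)) =
      B k (play a (ofRounds U B hB) (4 * k + 1), play a (ofRounds U B hB) (4 * k + 3)) := by
  have hV := play_ofRounds_add_four (U := U) (hB := hB) a (n := 4 * k) (by grind)
  have hW := play_ofRounds_add_four (U := U) (hB := hB) a (n := 4 * k + 2) (by grind)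
  rw [show 4 * k / 4 = k by lia, if_pos (by lia)] at hV
  rw [show (4 * k + 2) / 4 = k by lia, if_neg (by lia)] at hW
  exact Prod.ext hV hW

end BetaStrategy

/-- The open box in `X × X` with the given sides. -/
def box (S : Move X × Move X) : Set (X × X) := (S.1.1 : Set X) ×ˢ (S.2.1 : Set X)

theorem box_subset_box {S T : Move X × Move X} : box S ⊆ box T ↔ S ≤ T := by
  simp only [box, prod_subset_prod_iff]
  simp [S.1.2.ne_empty, S.2.2.ne_empty, Prod.le_def]

theorem exists_box_subset {O : Set (X × X)} (hO : IsOpen O) (hne : O.Nonempty) :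
    ∃ S, box S ⊆ O := by
  obtain ⟨⟨p, q⟩, hpq⟩ := hne
  obtain ⟨u, v, hu, hv, hpu, hqv, huv⟩ := isOpen_prod_iff.1 hO p q hpq
  exact ⟨(⟨⟨u, hu⟩, p, hpu⟩, ⟨⟨v, hv⟩, q, hqv⟩), huv⟩

theorem exists_le_box_subset {D : Set (X × X)} (hD : IsOpen D) (hDense : Dense D)
    (S : Move X × Move X) : ∃ T ≤ S, box T ⊆ D := by
  have hS : IsOpen (box S) := S.1.1.isOpen.prod S.2.1.isOpen
  obtain ⟨T, hT⟩ := exists_box_subset (hS.inter hD)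
    (hDense.inter_open_nonempty _ hS (S.1.2.prod S.2.2))
  exact ⟨T, box_subset_box.1 (hT.trans inter_subset_left), hT.trans inter_subset_right⟩

end TandemGame

theorem IsTauBaire.baireSpace_prod {X : Type*} [TopologicalSpace X] (h : IsTauBaire X) :
    BaireSpace (X × X) := by
  refine ⟨fun f ho hd ↦ dense_iff_inter_open.2 fun O hO hne ↦ ?_⟩
  obtain ⟨U, hU⟩ := exists_box_subset hO hne
  choose B hB hBf using fun k ↦ exists_le_box_subset (ho k) (hd k)
  obtain ⟨a, ⟨p, hp⟩, ⟨q, hq⟩⟩ := h (.ofRounds U B hB)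
  have hmem (k : ℕ) : (p, q) ∈ box (play a (.ofRounds U B hB) (4 * k),
      play a (.ofRounds U B hB) (4 * k + 2)) := ⟨mem_iInter.1 hp k, mem_iInter.1 hq k⟩
  refine ⟨(p, q), hU ?_, mem_iInter.2 fun k ↦ ?_⟩
  · have hopening := hmem 0
    rwa [BetaStrategy.play_ofRounds_opening] at hopening
  · have hround := hmem (k + 1)
    rw [BetaStrategy.play_ofRounds_succ] at hround
    exact hBf k _ hround

namespace TandemGame

variable {X P : Type*} [TopologicalSpace X]

/-- The strategy of player `α'` which answers the `k`-th move of `β'`, counted on both boards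
together, by means of the rule `r k`, with `d k` as a parameter. The value on the empty history is
irrelevant; it only has to be some move. -/
def followSeq (b : BetaStrategy X) (r : ℕ → P → Move X → Move X)
    (hr : ∀ k ε V, r k ε V ≤ V) (d : ℕ → P) : AlphaStrategy X where
  move
    | 0, s => b.move 0 s
    | n + 1, s => r (n / 2) (d (n / 2)) (s (Fin.last n))
  legal k s := hr (2 * k / 2) (d (2 * k / 2)) (s (Fin.last (2 * k)))

variable {b : BetaStrategy X} {r : ℕ → P → Move X → Move X} {hr : ∀ k ε V, r k ε V ≤ V}

theorem play_followSeq (d : ℕ → P) (k : ℕ) : play (followSeq b r hr d) b (2 * k + 1) =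
    r k (d k) (play (followSeq b r hr d) b (2 * k)) := by
  rw [play_of_odd _ _ (odd_two_mul_add_one k)]
  simp [followSeq]

theorem dependsOn_play_followSeq {m n : ℕ} (hn : n ≤ 2 * m) :
    DependsOn (fun d ↦ play (followSeq b r hr d) b n) (Iio m) := by
  intro d d' h
  dsimp only
  induction n using Nat.strong_induction_on with
  | _ n ih =>
    rcases Nat.even_or_odd' n with ⟨k, rfl | rfl⟩
    · rw [play_of_even _ _ (even_two_mul k), play_of_even _ _ (even_two_mul k)]
      congr 1
      funext i
      exact ih i i.2 (i.2.le.trans hn)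
    · rw [play_followSeq, play_followSeq, ih _ (by lia) (by lia), h k (by simp; lia)]

end TandemGame

namespace CPlus

theorem cof_eq : cof CPlus = succ 𝔠 := by
  rw [Ordinal.cof_toType, (isRegular_succ aleph0_le_continuum).cof_ord]

theorem continuum_lt_cof : 𝔠 < cof CPlus :=
  (lt_succ 𝔠).trans_eq cof_eq.symm

theorem aleph0_lt_cof : ℵ₀ < cof CPlus :=
  aleph0_lt_continuum.trans continuum_lt_cof

theorem mk_Iio_le (a : CPlus) : #(Iio a) ≤ 𝔠 :=
  lt_succ_iff.1 ((mk_Iio_lt a (by simp)).trans_eq (mk_ord_toType _))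

theorem mk_Iio_lt_cof (a : CPlus) : #(Iio a) < cof CPlus :=
  (mk_Iio_le a).trans_lt continuum_lt_cof

instance : NoMaxOrder CPlus := noMaxOrder_of_aleph0_lt_cof aleph0_lt_cof

instance : Nonempty CPlus := cof_ne_zero_iff.1 (aleph0_pos.trans aleph0_lt_cof).ne'

end CPlus

theorem mk_nat_to_fin_three : #(ℕ → Fin 3) = 𝔠 := by
  simpa using nat_power_aleph0 (n := 3) (by norm_num)

theorem exists_isDisjointStationaryFamily :
    ∃ A : (ℕ → Fin 3) → Set CPlus, IsDisjointStationaryFamily A := by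
  obtain ⟨A, hsub, hstat, hdisj⟩ := exists_pairwise_disjoint_isStationary_subset
    (ι := ℕ → Fin 3) (S := COmega) (mk_nat_to_fin_three.trans_lt CPlus.continuum_lt_cof)
    (fun a ↦ (CPlus.mk_Iio_le a).trans_eq mk_nat_to_fin_three.symm)
    (isStationary_setOf_cof_Iio_le_aleph0 CPlus.aleph0_lt_cof)
  exact ⟨A, hsub, hstat, hdisj⟩

namespace SpaceE

variable {A : (ℕ → Fin 3) → Set CPlus}

/-- The points of `E`, read as sequences of pairs. -/
def coords (p : SpaceE A) (i : ℕ) : Fin 3 × CPlus := (p.1.1 i, p.1.2 i)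

theorem isEmbedding_coords : IsEmbedding (coords : SpaceE A → ℕ → Fin 3 × CPlus) :=
  IsEmbedding.of_comp (g := fun u ↦ (fun i ↦ (u i).1, fun i ↦ (u i).2))
    (by unfold coords; fun_prop) (by fun_prop) .subtypeVal

theorem metrizableSpace (A : (ℕ → Fin 3) → Set CPlus) :
    TopologicalSpace.MetrizableSpace (SpaceE A) :=
  isEmbedding_coords.metrizableSpace

/-- The points of `E` with the same first `n` coordinates as `p`. -/
def cylinder (p : SpaceE A) (n : ℕ) : Set (SpaceE A) := coords ⁻¹' PiNat.cylinder (coords p) n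

theorem self_mem_cylinder (p : SpaceE A) (n : ℕ) : p ∈ cylinder p n :=
  PiNat.self_mem_cylinder _ n

theorem isOpen_cylinder (p : SpaceE A) (n : ℕ) : IsOpen (cylinder p n) :=
  (PiNat.isOpen_cylinder _ _ n).preimage isEmbedding_coords.continuous

theorem hasBasis_nhds (p : SpaceE A) : (𝓝 p).HasBasis (fun _ ↦ True) (cylinder p) :=
  isEmbedding_coords.nhds_eq_comap p ▸ (hasBasis_nhds_cylinder (coords p)).comap coords

theorem exists_branch_eq_and_lt (hA : ∀ y, IsStationary (A y)) (x : ℕ → Fin 3) (f : ℕ → CPlus)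
    (n : ℕ) (ε : CPlus) :
    ∃ p : SpaceE A, p.1.1 = x ∧ (∀ i < n, p.1.2 i = f i) ∧ ε < p.1.2 n := by
  obtain ⟨b, hb⟩ := exists_forall_apply_lt (mk_nat.trans_lt CPlus.aleph0_lt_cof) f
  obtain ⟨γ, hγA, hγ⟩ := hA (fun i ↦ x i + 1) (isClub_Ioi (max b ε))
  obtain ⟨hbγ, hεγ⟩ := max_lt_iff.1 (mem_Ioi.1 hγ)
  let g (i : ℕ) : CPlus := if i < n then f i else γ
  have hg : g n = γ := if_neg (lt_irrefl n)
  have hlub : IsLUB (range g) γ := by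
    refine ⟨forall_mem_range.2 fun i ↦ ?_, fun u hu ↦ hg ▸ hu (mem_range_self n)⟩
    by_cases hi : i < n
    · exact (if_pos hi).trans_le ((hb i).trans hbγ).le
    · exact (if_neg hi).le
  exact ⟨⟨(x, g), γ, ⟨_, fun i ↦ by simp, hγA⟩, hlub⟩, rfl, fun i hi ↦ if_pos hi, hg ▸ hεγ⟩

theorem exists_mem_cylinder_lt (hA : ∀ y, IsStationary (A y)) (p : SpaceE A) (n : ℕ) (ε : CPlus) :
    ∃ q ∈ cylinder p n, ε < q.1.2 n := by
  obtain ⟨q, hx, hf, hε⟩ := exists_branch_eq_and_lt hA p.1.1 p.1.2 n ε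
  exact ⟨q, fun i hi ↦ Prod.ext (congrFun hx i) (hf i hi), hε⟩

/-- The cylinders as moves in the game. -/
def cylinderMove (p : SpaceE A) (n : ℕ) : Move (SpaceE A) :=
  ⟨⟨cylinder p n, isOpen_cylinder p n⟩, p, self_mem_cylinder p n⟩

theorem exists_cylinderMove_le (hA : ∀ y, IsStationary (A y)) (k : ℕ) (ε : CPlus)
    (V : Move (SpaceE A)) :
    ∃ p n, cylinderMove p n ≤ V ∧ k < n ∧ ∃ i < n, ε < p.1.2 i := by
  obtain ⟨p, hp⟩ := V.2
  obtain ⟨n, -, hn⟩ := (hasBasis_nhds p).mem_iff.1 (V.1.isOpen.mem_nhds hp)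
  obtain ⟨q, hq, hε⟩ := exists_mem_cylinder_lt hA p n ε
  refine ⟨q, max n k + 1, fun r hr ↦ hn ?_, by lia, n, by lia, hε⟩
  exact fun i hi ↦ (hr i (by lia)).trans (hq i hi)

/-- A rule by which player `α'` answers with cylinders: in its `k`-th move, counted on both boards
together, the answer to `V` with the parameter `ε` is the cylinder of length `length k ε V` around
`center k ε V`. The answer decides at least the coordinates up to `k`, and one of the ordinals that
it decides exceeds `ε`. -/
structure CylinderRule (A : (ℕ → Fin 3) → Set CPlus) where
  center : ℕ → CPlus → Move (SpaceE A) → SpaceE A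
  length : ℕ → CPlus → Move (SpaceE A) → ℕ
  cylinderMove_le : ∀ k ε V, cylinderMove (center k ε V) (length k ε V) ≤ V
  lt_length : ∀ k ε V, k < length k ε V
  exists_lt : ∀ k ε V, ∃ i < length k ε V, ε < (center k ε V).1.2 i

theorem nonempty_cylinderRule (hA : ∀ y, IsStationary (A y)) : Nonempty (CylinderRule A) := by
  choose p n hle hlt hex using exists_cylinderMove_le hA
  exact ⟨⟨p, n, hle, hlt, hex⟩⟩

namespace CylinderRule

variable (ρ : CylinderRule A) (b : BetaStrategy (SpaceE A)) (d : ℕ → CPlus)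

/-- The strategy of player `α'` which follows the rule `ρ` with the parameters `d` against `b`. -/
def strategy : AlphaStrategy (SpaceE A) :=
  followSeq b (fun k ε V ↦ cylinderMove (ρ.center k ε V) (ρ.length k ε V)) ρ.cylinderMove_le d

/-- The centre of the `k`-th cylinder that `α'` plays. -/
def pt (k : ℕ) : SpaceE A := ρ.center k (d k) (play (ρ.strategy b d) b (2 * k))

/-- The length of the `k`-th cylinder that `α'` plays. -/
def len (k : ℕ) : ℕ := ρ.length k (d k) (play (ρ.strategy b d) b (2 * k))

/-- The common coordinates of the cylinders that `α'` plays on board `i`, where `i` is `0` or `1`: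
the moves of `α'` on that board are its moves number `2 * k + i`. -/
def limit (i j : ℕ) : Fin 3 × CPlus := coords (ρ.pt b d (2 * j + i)) j

theorem play_strategy (k : ℕ) :
    play (ρ.strategy b d) b (2 * k + 1) = cylinderMove (ρ.pt b d k) (ρ.len b d k) :=
  play_followSeq d k

theorem dependsOn_pt (k : ℕ) : DependsOn (fun d ↦ ρ.pt b d k) (Iio (k + 1)) := by
  intro d d' h
  have hplay : play (ρ.strategy b d) b (2 * k) = play (ρ.strategy b d') b (2 * k) :=
    dependsOn_play_followSeq le_rfl fun i hi ↦ h i (hi.trans k.lt_succ_self)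
  simp only [pt, hplay, h k k.lt_succ_self]

theorem continuous_limit_apply (i j : ℕ) : Continuous fun d ↦ ρ.limit b d i j :=
  continuous_of_dependsOn_Iio fun _ _ h ↦ congrArg (coords · j) (ρ.dependsOn_pt b _ h)

theorem play_le_play (i : ℕ) {k l : ℕ} (hkl : k ≤ l) :
    play (ρ.strategy b d) b (2 * (2 * l + i) + 1) ≤
      play (ρ.strategy b d) b (2 * (2 * k + i) + 1) := by
  induction l, hkl using Nat.le_induction with
  | base => exact le_rfl
  | succ l _ ih =>
    have hβ := play_two_mul_add_four_le (ρ.strategy b d) b (2 * l + i)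
    rw [show 2 * (2 * l + i) + 4 = 2 * (2 * (l + 1) + i) by lia] at hβ
    exact ((play_two_mul_add_one_le _ _ _).trans hβ).trans ih

theorem pt_mem_cylinder (i : ℕ) {k l : ℕ} (hkl : k ≤ l) :
    ρ.pt b d (2 * l + i) ∈ cylinder (ρ.pt b d (2 * k + i)) (ρ.len b d (2 * k + i)) := by
  have hle := ρ.play_le_play b d i hkl
  rw [play_strategy, play_strategy] at hle
  exact hle (self_mem_cylinder _ _)

theorem limit_mem_cylinder (i k : ℕ) :
    ρ.limit b d i ∈ PiNat.cylinder (coords (ρ.pt b d (2 * k + i))) (ρ.len b d (2 * k + i)) := by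
  intro j hj
  rcases le_total k j with hkj | hjk
  · exact ρ.pt_mem_cylinder b d i hkj j hj
  · have hlen : 2 * j + i < ρ.len b d (2 * j + i) := ρ.lt_length _ _ _
    exact (ρ.pt_mem_cylinder b d i hjk j (by lia)).symm

theorem mem_play {p : SpaceE A} {i : ℕ} (hp : coords p = ρ.limit b d i) (k : ℕ) :
    p ∈ (play (ρ.strategy b d) b (4 * k + 2 * i)).1 := by
  rw [show 4 * k + 2 * i = 2 * (2 * k + i) by lia]
  refine play_two_mul_add_one_le (ρ.strategy b d) b _ ?_
  rw [play_strategy]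
  change coords p ∈ PiNat.cylinder _ _
  exact hp ▸ ρ.limit_mem_cylinder b d i k

variable {ρ b d}

theorem isLUB_limit {γ : CPlus} {i : ℕ} (hγ : ∀ j, (ρ.limit b d i j).2 < γ)
    (hd : ∀ ε < γ, ∀ᶠ n in atTop, ε ≤ d n) : IsLUB (range fun j ↦ (ρ.limit b d i j).2) γ := by
  refine ⟨forall_mem_range.2 fun j ↦ (hγ j).le, fun u hu ↦ not_lt.1 fun huγ ↦ ?_⟩
  obtain ⟨m, hm⟩ := eventually_atTop.1 (hd u huγ)
  obtain ⟨j, hj, hlt⟩ : ∃ j < ρ.len b d (2 * m + i), d (2 * m + i) < (ρ.pt b d (2 * m + i)).1.2 j :=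
    ρ.exists_lt _ _ _
  have hlim : (ρ.limit b d i j).2 = (ρ.pt b d (2 * m + i)).1.2 j :=
    congrArg Prod.snd (ρ.limit_mem_cylinder b d i m j hj)
  exact ((hm _ (by lia)).trans_lt hlt).not_ge (hlim ▸ hu (mem_range_self j))

theorem exists_forall_mem_play {γ : CPlus} {i : ℕ} (hγ : ∀ j, (ρ.limit b d i j).2 < γ)
    (hd : ∀ ε < γ, ∀ᶠ n in atTop, ε ≤ d n) {y : ℕ → Fin 3} (hy : ∀ n, y n ≠ (ρ.limit b d i n).1)
    (hγA : γ ∈ A y) : ∃ p : SpaceE A, ∀ k, p ∈ (play (ρ.strategy b d) b (4 * k + 2 * i)).1 :=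
  ⟨⟨(fun j ↦ (ρ.limit b d i j).1, fun j ↦ (ρ.limit b d i j).2), γ, ⟨y, hy, hγA⟩,
    isLUB_limit hγ hd⟩, ρ.mem_play b d rfl⟩

end CylinderRule

theorem exists_forall_ne_ne (x x' : ℕ → Fin 3) : ∃ y : ℕ → Fin 3, ∀ n, y n ≠ x n ∧ y n ≠ x' n := by
  have hfin : ∀ i j : Fin 3, ∃ k, k ≠ i ∧ k ≠ j := by decide
  choose y hy using fun n ↦ hfin (x n) (x' n)
  exact ⟨y, hy⟩

theorem isTauBaire (hA : IsDisjointStationaryFamily A) : IsTauBaire (SpaceE A) := by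
  intro b
  obtain ⟨ρ⟩ := nonempty_cylinderRule hA.stationary
  have hcont := ρ.continuous_limit_apply b
  obtain ⟨r, C, hC, hbranch⟩ := exists_isClub_exists_apply_eq CPlus.aleph0_lt_cof
    CPlus.mk_Iio_lt_cof (R := (ℕ → Fin 3) × (ℕ → Fin 3))
    (Φ := fun d ↦ (fun j ↦ (ρ.limit b d 0 j).1, fun j ↦ (ρ.limit b d 1 j).1))
    (by simpa only [mk_prod, lift_id, mk_nat_to_fin_three, continuum_mul_self]
      using CPlus.continuum_lt_cof)
    ((continuous_pi fun j ↦ (hcont 0 j).fst).prodMk (continuous_pi fun j ↦ (hcont 1 j).fst))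
  obtain ⟨C', hC', hbound⟩ := exists_isClub_forall_apply_lt CPlus.aleph0_lt_cof
    CPlus.mk_Iio_lt_cof (F := fun (ij : ℕ × ℕ) d ↦ (ρ.limit b d ij.1 ij.2).2)
    fun ij ↦ (hcont ij.1 ij.2).snd
  obtain ⟨y, hy⟩ := exists_forall_ne_ne r.1 r.2
  obtain ⟨γ, hγA, hγC, hγC'⟩ := hA.stationary y (hC.inter CPlus.aleph0_lt_cof.ne' hC')
  obtain ⟨d, hdγ, hd, rfl⟩ := hbranch γ hγC (hA.subset y hγA)
  have hlt (i j : ℕ) : (ρ.limit b d i j).2 < γ := hbound γ hγC' d hdγ (i, j)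
  obtain ⟨p, hp⟩ := ρ.exists_forall_mem_play (hlt 0) hd (fun n ↦ (hy n).1) hγA
  obtain ⟨q, hq⟩ := ρ.exists_forall_mem_play (hlt 1) hd (fun n ↦ (hy n).2) hγA
  exact ⟨ρ.strategy b d, ⟨p, mem_iInter.2 hp⟩, ⟨q, mem_iInter.2 hq⟩⟩

/-- The supremum of the sequence of ordinals of a point of `E`. -/
noncomputable def ordinalSup (p : SpaceE A) : CPlus := p.2.choose

theorem ordinalSup_mem_unionAvoiding (p : SpaceE A) : ordinalSup p ∈ unionAvoiding A p.1.1 :=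
  p.2.choose_spec.1

theorem isLUB_ordinalSup (p : SpaceE A) : IsLUB (range p.1.2) (ordinalSup p) :=
  p.2.choose_spec.2

theorem isOpen_setOf_exists_le (n : ℕ) :
    IsOpen {z : SpaceE A × SpaceE A | ∃ m, z.1.1.2 n ≤ z.2.1.2 m} := by
  simp only [ofPred_exists]
  refine isOpen_iUnion fun m ↦ ?_
  exact (isOpen_discrete {w : CPlus × CPlus | w.1 ≤ w.2}).preimage
    (f := fun z : SpaceE A × SpaceE A ↦ (z.1.1.2 n, z.2.1.2 m)) (by fun_prop)

theorem dense_setOf_exists_le (hA : ∀ y, IsStationary (A y)) (n : ℕ) :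
    Dense {z : SpaceE A × SpaceE A | ∃ m, z.1.1.2 n ≤ z.2.1.2 m} := by
  intro ⟨p, q⟩
  have hq : q ∈ closure {q : SpaceE A | ∃ m, p.1.2 n ≤ q.1.2 m} :=
    (mem_closure_iff_nhds_basis (hasBasis_nhds q)).2 fun k _ ↦
      (exists_mem_cylinder_lt hA q k (p.1.2 n)).imp fun _ h ↦ ⟨⟨k, h.2.le⟩, h.1⟩
  exact map_mem_closure (Continuous.prodMk_right p) hq fun _ h ↦ h

theorem eventually_residual_ordinalSup_le (hA : ∀ y, IsStationary (A y)) :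
    ∀ᶠ z : SpaceE A × SpaceE A in residual _, ordinalSup z.1 ≤ ordinalSup z.2 := by
  have hle : ∀ᶠ z : SpaceE A × SpaceE A in residual _, ∀ n, ∃ m, z.1.1.2 n ≤ z.2.1.2 m :=
    eventually_countable_forall.2 fun n ↦
      residual_of_dense_open (isOpen_setOf_exists_le n) (dense_setOf_exists_le hA n)
  filter_upwards [hle] with z hz
  refine (isLUB_le_iff (isLUB_ordinalSup z.1)).2 (forall_mem_range.2 fun n ↦ ?_)
  obtain ⟨m, hm⟩ := hz n
  exact hm.trans ((isLUB_ordinalSup z.2).1 (mem_range_self m))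

theorem eventually_residual_ordinalSup_eq (hA : ∀ y, IsStationary (A y)) :
    ∀ᶠ z : SpaceE A × SpaceE A in residual _, ordinalSup z.1 = ordinalSup z.2 := by
  have hle := eventually_residual_ordinalSup_le hA
  have hge := (tendsto_residual_of_isOpenMap continuous_swap
    (Homeomorph.prodComm (SpaceE A) (SpaceE A)).isOpenMap).eventually hle
  filter_upwards [hle, hge] with z hz hz' using hz.antisymm hz'

theorem not_forall_ordinalSup_eq (hA : ∀ y z, y ≠ z → Disjoint (A y) (A z)) {p : Fin 3 → SpaceE A}
    {n : ℕ} (hp : ∀ i, (p i).1.1 n = i) {γ : CPlus} : ¬ ∀ i, ordinalSup (p i) = γ := by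
  intro hγ
  choose y hy hyA using fun i ↦ ordinalSup_mem_unionAvoiding (p i)
  have hconst (i : Fin 3) : y i = y 0 := by
    by_contra hne
    exact Set.disjoint_left.1 (hA _ _ hne) (hγ i ▸ hyA i) (hγ 0 ▸ hyA 0)
  exact hy (y 0 n) n ((congrFun (hconst _) n).trans (hp _).symm)

theorem not_baireSpace_cube (hA : IsDisjointStationaryFamily A) :
    ¬ BaireSpace (SpaceE A × SpaceE A × SpaceE A) := by
  intro _
  have heq := eventually_residual_ordinalSup_eq hA.stationary
  have hdense : Dense {z : SpaceE A × SpaceE A × SpaceE A |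
      ordinalSup z.1 = ordinalSup z.2.1 ∧ ordinalSup z.2.1 = ordinalSup z.2.2} :=
    dense_of_mem_residual <|
      ((tendsto_residual_of_isOpenMap (continuous_id.prodMap continuous_fst)
        (IsOpenMap.id.prodMap isOpenMap_fst)).eventually heq).and
      ((tendsto_residual_of_isOpenMap continuous_snd isOpenMap_snd).eventually heq)
  obtain ⟨o⟩ : Nonempty CPlus := inferInstance
  have hopen (i : Fin 3) : IsOpen {p : SpaceE A | p.1.1 0 = i} :=
    (isOpen_discrete {i}).preimage (f := fun p : SpaceE A ↦ p.1.1 0) (by fun_prop)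
  have hne (i : Fin 3) : {p : SpaceE A | p.1.1 0 = i}.Nonempty :=
    (exists_branch_eq_and_lt hA.stationary (fun _ ↦ i) (fun _ ↦ o) 0 o).imp
      fun p h ↦ show p.1.1 0 = i from congrFun h.1 0
  obtain ⟨⟨p₀, p₁, p₂⟩, ⟨h₀, h₁, h₂⟩, h₀₁, h₁₂⟩ := hdense.inter_open_nonempty _
    ((hopen 0).prod ((hopen 1).prod (hopen 2))) ((hne 0).prod ((hne 1).prod (hne 2)))
  exact not_forall_ordinalSup_eq hA.disjoint (p := ![p₀, p₁, p₂])
    (fun | 0 => h₀ | 1 => h₁ | 2 => h₂) (fun | 0 => h₀₁ | 1 => rfl | 2 => h₁₂.symm)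

theorem not_isTauBaire_square (hA : IsDisjointStationaryFamily A) :
    ¬ IsTauBaire (SpaceE A × SpaceE A) := by
  intro h
  have := h.baireSpace_prod
  obtain ⟨o⟩ : Nonempty CPlus := inferInstance
  have : Nonempty (SpaceE A) :=
    (exists_branch_eq_and_lt hA.stationary (fun _ ↦ 0) (fun _ ↦ o) 0 o).nonempty
  have hquot : IsOpenQuotientMap
      (Prod.map Prod.fst id : (SpaceE A × SpaceE A) × SpaceE A × SpaceE A → _) :=
    ⟨Prod.fst_surjective.prodMap Function.surjective_id, by fun_prop, isOpenMap_fst.prodMap .id⟩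
  exact not_baireSpace_cube hA hquot.baireSpace

end SpaceE

theorem proposition9p1 :
    (∃ A : (ℕ → Fin 3) → Set CPlus, IsDisjointStationaryFamily A) ∧
    ∀ A : (ℕ → Fin 3) → Set CPlus, IsDisjointStationaryFamily A →
      TopologicalSpace.MetrizableSpace (SpaceE A) ∧
      IsTauBaire (SpaceE A) ∧
      BaireSpace (SpaceE A × SpaceE A) ∧
      ¬ BaireSpace (SpaceE A × SpaceE A × SpaceE A) ∧
      ¬ IsTauBaire (SpaceE A × SpaceE A) := by
  refine ⟨exists_isDisjointStationaryFamily, fun A hA ↦ ?_⟩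
  have hτ : IsTauBaire (SpaceE A) := SpaceE.isTauBaire hA
  exact ⟨SpaceE.metrizableSpace A, hτ, hτ.baireSpace_prod, SpaceE.not_baireSpace_cube hA,
    SpaceE.not_isTauBaire_square hA⟩
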